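/- Conventions. All structures are relational with countable domain; signatures may be arbitrary. A structure is $\omega$-categorical if its automorphism group has finitely many orbits on $n$-tuples for every $n$, and homogeneous if every isomorphism between finite induced substructures extends to an automorphism. The age of a structure is the class of finite structures that embed into it. A structure $\mathbb B$ is Ramsey if for all $\mathbb S,\mathbb F$ in its age and every colouring of the embeddings $\mathbb S\to\mathbb B$ with two colours there is an embedding $f\colon\mathbb F\to\mathbb B$ such that all $f\circ e$, with $e\colon\mathbb S\to\mathbb F$ an embedding, have the same colour. It is finitely bounded if its signature is finite and there is a finite set $\mathcal F$ of finite structures such that a finite structure belongs to its age if and only if it embeds no member of $\mathcal F$. A first-order reduct of $\mathbb B$ is a structure $\mathbb A$ on the same domain all of whose relations are first-order definable in $\mathbb B$ without parameters. A structure is a model-complete core if its automorphisms are dense in its endomorphisms in the topology of pointwise convergence; a model-complete core of $\mathbb A$ is a (countable) model-complete core $\mathbb A'$ such that there are homomorphisms $\mathbb A\to\mathbb A'$ and $\mathbb A'\to\mathbb A$. A left ideal of $\mathrm{End}(\mathbb A)$ is a non-empty subset $I$ with $h\circ f\in I$ for all $h\in\mathrm{End}(\mathbb A)$, $f\in I$;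 a minimal closed left ideal is a minimal one among those that are closed under pointwise convergence. A function $g\colon B\to B$ is range-rigid with respect to $\mathrm{Aut}(\mathbb B)$ if for every $\beta\in\mathrm{Aut}(\mathbb B)$ it lies in the pointwise closure of $\{\alpha\circ g\circ\beta\circ g\mid\alpha\in\mathrm{Aut}(\mathbb B)\}$. Theorem 1.4. Let $\mathbb A$ be a first-order reduct of an $\omega$-categorical homogeneous Ramsey structure $\mathbb B$. Then $\mathrm{End}(\mathbb A)$ has a minimal closed left ideal containing a function that is range-rigid with respect to $\mathrm{Aut}(\mathbb B)$. Moreover, for every range-rigid $g$ lying in some minimal closed left ideal of $\mathrm{End}(\mathbb A)$ there is an induced substructure $\mathbb B'=\mathbb B_g$ of $\mathbb B$ that is a Fraïssé limit of the age of the substructure of $\mathbb B$ induced on the range of $g$ (that is, it is homogeneous and has that age), and such that, writing $\mathbb A_g$ for the substructure of $\mathbb A$ induced on the domain of $\mathbb B'$: 1. $\mathbb B'$ is $\omega$-categorical, homogeneous and Ramsey; 2. if $\mathbb B$ is finitely bounded, then so is $\mathbb B'$; 3. $\mathbb A_g$ is a first-order reduct of $\mathbb B'$; 4. $\mathbb A_g$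 is a model-complete core of $\mathbb A$, and every model-complete core $\mathbb A'$ of $\mathbb A$ is isomorphic to $\mathbb A_g$. In particular the model-complete core $\mathbb A'$ of $\mathbb A$ is, up to isomorphism, a first-order reduct of the $\omega$-categorical homogeneous Ramsey structure $\mathbb B'$, which is an induced substructure of $\mathbb B$ and is finitely bounded if $\mathbb B$ is. -/

import Mathlib

open scoped FirstOrder

universe u v u' v' w w'

namespace CoreRamsey

open FirstOrder.Language

/-- The induced substructure of a relational structure on an arbitrary subset `S` of its domain.
Being indexed by a plain set, it provides structures for several languages on the same type. -/
instance (priority := low) inducedStructure (L : FirstOrder.Language.{u, v}) [L.IsRelational]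
    {M : Type w} [L.Structure M] (S : Set M) : L.Structure S where
  funMap f _ := isEmptyElim f
  RelMap R x := Structure.RelMap R (fun i => (x i : M))

/-- `ω`-categoricity of a (countable) structure: the automorphism group is oligomorphic, i.e. for
each `n` it has only finitely many orbits on `n`-tuples (`T` is a finite set meeting every orbit). -/
def IsOmegaCategorical (L : FirstOrder.Language.{u, v}) (M : Type w) [L.Structure M] : Prop :=
  ∀ n : ℕ, ∃ T : Set (Fin n → M), T.Finite ∧
    ∀ x : Fin n → M, ∃ t ∈ T, ∃ α : M ≃[L] M, ∀ i, α (t i) = x i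

/-- The Ramsey property. Copies of `S` are embeddings of `S`; every colouring of the copies of `S`
in `M` with two colours is constant on the copies of `S` inside some copy of `F` in `M`. -/
def IsRamsey (L : FirstOrder.Language.{u, v}) (M : Type w) [L.Structure M] : Prop :=
  ∀ S ∈ L.age M, ∀ F ∈ L.age M, ∀ χ : (S ↪[L] M) → Bool,
    ∃ f : F ↪[L] M, ∀ e e' : S ↪[L] F, χ (f.comp e) = χ (f.comp e')

/-- A structure is finitely bounded if its signature is finite and its age consists, among the
finite structures, of those embedding no member of some finite set of finite structures. -/
def IsFinitelyBounded (L : FirstOrder.Language.{u, v}) (M : Type w) [L.Structure M] : Prop :=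
  Finite L.Symbols ∧
    ∃ 𝓕 : Set (CategoryTheory.Bundled.{w} L.Structure), 𝓕.Finite ∧ (∀ F ∈ 𝓕, Finite F) ∧
      ∀ N : CategoryTheory.Bundled.{w} L.Structure, Finite N →
        (N ∈ L.age M ↔ ∀ F ∈ 𝓕, IsEmpty (F ↪[L] N))

/-- The relational `LA`-structure on `M` is a first-order reduct of the `LB`-structure on `M`:
each of its relations is definable by a first-order `LB`-formula without parameters. -/
def IsFirstOrderReduct (LA : FirstOrder.Language.{u, v}) (LB : FirstOrder.Language.{u', v'}) (M : Type w)
    [LA.Structure M] [LB.Structure M] : Prop :=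
  ∀ (n : ℕ) (R : LA.Relations n),
    (∅ : Set M).Definable LB {x : Fin n → M | Structure.RelMap R x}

/-- A model-complete core: the automorphisms are dense in the endomorphisms in the topology of
pointwise convergence. -/
def IsModelCompleteCore (L : FirstOrder.Language.{u, v}) (N : Type w) [L.Structure N] : Prop :=
  ∀ (e : N →[L] N) (F : Finset N), ∃ α : N ≃[L] N, ∀ x ∈ F, α x = e x

/-- `N` is a model-complete core that is homomorphically equivalent to `M`. -/
def IsModelCompleteCoreOf (L : FirstOrder.Language.{u, v}) (N : Type w) [L.Structure N]
    (M : Type w') [L.Structure M] : Prop :=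
  IsModelCompleteCore L N ∧ Nonempty (N →[L] M) ∧ Nonempty (M →[L] N)

/-- `g` is range-rigid with respect to the automorphism group of `M`: for every automorphism `β`,
the function `g` lies in the pointwise closure of `{α ∘ g ∘ β ∘ g | α ∈ Aut M}`. -/
def IsRangeRigid (L : FirstOrder.Language.{u, v}) {M : Type w} [L.Structure M] (g : M → M) : Prop :=
  ∀ (β : M ≃[L] M) (F : Finset M), ∃ α : M ≃[L] M, ∀ x ∈ F, α (g (β (g x))) = g x

/-- Non-empty closed left ideals of the endomorphism monoid of `M`. Closedness is with respect to
pointwise convergence; as the endomorphism monoid is itself closed in `M → M`, it does not matter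
whether the closure is taken in `M → M` or among the endomorphisms. -/
structure IsClosedLeftIdeal (L : FirstOrder.Language.{u, v}) {M : Type w} [L.Structure M]
    (I : Set (M →[L] M)) : Prop where
  nonempty : I.Nonempty
  comp_mem : ∀ (h : M →[L] M), ∀ f ∈ I, h.comp f ∈ I
  closed : ∀ f : M →[L] M, (∀ F : Finset M, ∃ h ∈ I, ∀ x ∈ F, h x = f x) → f ∈ I

/-- The endomorphism `g` lies in some minimal closed left ideal of the endomorphism monoid. -/
def InMinimalClosedLeftIdeal (L : FirstOrder.Language.{u, v}) {M : Type w} [L.Structure M]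
    (g : M →[L] M) : Prop :=
  ∃ I : Set (M →[L] M), Minimal (IsClosedLeftIdeal L) I ∧ g ∈ I

end CoreRamsey

/-! Write 𝔹 and 𝔸 for the `LB`- and `LA`-structures on `M`. Since Aut(𝔹) has finitely many orbits on
n-tuples for each n, functions into `M` are compact modulo automorphisms: ultrafilter limits exist
(`IsOmegaCategorical.exists_limit`). With Zorn this yields a minimal closed left ideal. Lying in
such an ideal means that every h ∘ f can be turned back into f locally (`IsMinimalEnd`). The Ramsey
property makes such an f canonical. The canonical ones form a semigroup, and the limit along an
idempotent ultrafilter on it is range-rigid (`exists_isRangeRigid`).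

For range-rigid g, a finite set has an automorphic image inside the range of g iff g itself agrees
with an automorphism on it ("good", `IsRangeRigid.isGood`). Hence good sets amalgamate, and a
generic set S with all finite parts good (`IsRich`) carries the Fraïssé limit. Finite partial maps
of S induced by Aut(𝔹) extend to Aut(S) (`IsRich.exists_equiv`), and some h : M → S agrees locally
with g up to automorphisms (`IsRich.exists_map`). Orbits on S are therefore traces of orbits on `M`,
which gives ω-categoricity and definability; the Ramsey property is pushed along h, and finite
bounds are checked through g.

Finally, minimality makes every endomorphism of the reduct on S locally invertible, and a
back-and-forth turns local invertibility into both the core property and the uniqueness of the core.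
-/

namespace CoreRamsey

open FirstOrder.Language Filter

/-! ### Generic sets and back-and-forth -/

section Generic

/-- A Rasiowa–Sikorski type lemma: given countably many requirements that can be met by enlarging
finite conditions, there is a set approximated by conditions that meets all of them. -/
theorem exists_generic_set {Z ι : Type*} [Countable ι] (P : Finset Z → Prop) (p₀ : Finset Z)
    (hp₀ : P p₀) (D : ι → Finset Z → Prop)
    (hD : ∀ i p, P p → ∃ q, p ⊆ q ∧ P q ∧ D i q) :
    ∃ R : Set Z, (∀ z ∈ p₀, z ∈ R) ∧
      (∀ F : Finset Z, (∀ z ∈ F, z ∈ R) → ∃ q, P q ∧ F ⊆ q ∧ ∀ z ∈ q, z ∈ R) ∧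
      ∀ i, ∃ q, (∀ z ∈ q, z ∈ R) ∧ P q ∧ D i q := by
  classical
  have := Encodable.ofCountable ι
  let 𝒟 : ι → Order.Cofinal {p : Finset Z // P p} := fun i =>
    { carrier := {p | D i p.1}
      isCofinal := fun p => by
        obtain ⟨q, hpq, hq, hd⟩ := hD i p.1 p.2
        exact ⟨⟨q, hq⟩, hd, hpq⟩ }
  let I := Order.idealOfCofinals (⟨p₀, hp₀⟩ : {p : Finset Z // P p}) 𝒟
  refine ⟨{z | ∃ p ∈ I, z ∈ p.1}, fun z hz => ⟨_, Order.mem_idealOfCofinals _ 𝒟, hz⟩, ?_, ?_⟩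
  · intro F h
    suffices ∃ p ∈ I, F ⊆ p.1 by
      obtain ⟨p, hp, hF⟩ := this
      exact ⟨p.1, p.2, hF, fun z hz => ⟨p, hp, hz⟩⟩
    induction F using Finset.induction_on with
    | empty => exact ⟨_, Order.mem_idealOfCofinals _ 𝒟, by simp⟩
    | insert b F _ ih =>
      obtain ⟨p, hp, hF⟩ := ih fun z hz => h z (Finset.mem_insert_of_mem hz)
      obtain ⟨q, hq, hb⟩ := h b (Finset.mem_insert_self _ _)
      obtain ⟨r, hr, hpr, hqr⟩ := I.directed p hp q hq
      exact ⟨r, hr, Finset.insert_subset (hqr hb) (hF.trans hpr)⟩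
  · intro i
    obtain ⟨x, hx, hxI⟩ := Order.cofinal_meets_idealOfCofinals
      (⟨p₀, hp₀⟩ : {p : Finset Z // P p}) 𝒟 i
    exact ⟨x.1, fun z hz => ⟨x, hxI, hz⟩, x.2, hx⟩

/-- Construction of a function from finite approximations. -/
theorem exists_fun_of_forth {X Y : Type*} [Countable X] (P : Finset (X × Y) → Prop)
    (p₀ : Finset (X × Y)) (hp₀ : P p₀)
    (hP : ∀ p, P p → ∀ a b b', (a, b) ∈ p → (a, b') ∈ p → b = b')
    (forth : ∀ p, P p → ∀ a, ∃ q, p ⊆ q ∧ P q ∧ ∃ b, (a, b) ∈ q) :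
    ∃ f : X → Y, (∀ a b, (a, b) ∈ p₀ → f a = b) ∧
      ∀ E : Finset X, ∃ p, P p ∧ ∀ a ∈ E, (a, f a) ∈ p := by
  classical
  obtain ⟨R, h0, hF, hm⟩ := exists_generic_set P p₀ hp₀ (fun a q => ∃ b, (a, b) ∈ q)
    (fun a p hp => forth p hp a)
  have hex : ∀ a, ∃ b, (a, b) ∈ R := fun a => by
    obtain ⟨q, hq, -, b, hb⟩ := hm a
    exact ⟨b, hq _ hb⟩
  have huniq : ∀ a b b', (a, b) ∈ R → (a, b') ∈ R → b = b' := fun a b b' h h' => by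
    obtain ⟨q, hq, hs, -⟩ := hF {(a, b), (a, b')} (by simp [h, h'])
    exact hP q hq a b b' (hs (by simp)) (hs (by simp))
  choose f hf using hex
  refine ⟨f, fun a b h => huniq a _ _ (hf a) (h0 _ h), fun E => ?_⟩
  obtain ⟨q, hq, hs, -⟩ := hF (E.image fun a => (a, f a)) (by
    intro z hz
    obtain ⟨a, -, rfl⟩ := Finset.mem_image.1 hz
    exact hf a)
  exact ⟨q, hq, fun a ha => hs (Finset.mem_image_of_mem _ ha)⟩

/-- Construction of a bijection by going back and forth. -/
theorem exists_equiv_of_back_and_forth {X Y : Type*} [Countable X] [Countable Y]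
    (P : Finset (X × Y) → Prop) (p₀ : Finset (X × Y)) (hp₀ : P p₀)
    (hP : ∀ p, P p → ∀ a b a' b', (a, b) ∈ p → (a', b') ∈ p → (a = a' ↔ b = b'))
    (forth : ∀ p, P p → ∀ a, ∃ q, p ⊆ q ∧ P q ∧ ∃ b, (a, b) ∈ q)
    (back : ∀ p, P p → ∀ b, ∃ q, p ⊆ q ∧ P q ∧ ∃ a, (a, b) ∈ q) :
    ∃ f : X ≃ Y, (∀ a b, (a, b) ∈ p₀ → f a = b) ∧
      ∀ E : Finset X, ∃ p, P p ∧ ∀ a ∈ E, (a, f a) ∈ p := by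
  classical
  obtain ⟨R, h0, hF, hm⟩ := exists_generic_set P p₀ hp₀
    (fun i : X ⊕ Y => fun q => i.elim (fun a => ∃ b, (a, b) ∈ q) (fun b => ∃ a, (a, b) ∈ q))
    (fun i p hp => i.casesOn (forth p hp) (back p hp))
  have hex : ∀ a, ∃ b, (a, b) ∈ R := fun a => by
    obtain ⟨q, hq, -, b, hb⟩ := hm (.inl a)
    exact ⟨b, hq _ hb⟩
  have hex' : ∀ b, ∃ a, (a, b) ∈ R := fun b => by
    obtain ⟨q, hq, -, a, ha⟩ := hm (.inr b)
    exact ⟨a, hq _ ha⟩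
  have huniq : ∀ a b a' b', (a, b) ∈ R → (a', b') ∈ R → (a = a' ↔ b = b') :=
    fun a b a' b' h h' => by
      obtain ⟨q, hq, hs, -⟩ := hF {(a, b), (a', b')} (by simp [h, h'])
      exact hP q hq a b a' b' (hs (by simp)) (hs (by simp))
  choose f hf using hex
  choose k hk using hex'
  refine ⟨⟨f, k, fun a => (huniq _ _ _ _ (hk (f a)) (hf a)).2 rfl,
    fun b => (huniq _ _ _ _ (hf (k b)) (hk b)).1 rfl⟩,
    fun a b h => (huniq _ _ _ _ (hf a) (h0 _ h)).1 rfl, fun E => ?_⟩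
  obtain ⟨q, hq, hs, -⟩ := hF (E.image fun a => (a, f a)) (by
    intro z hz
    obtain ⟨a, -, rfl⟩ := Finset.mem_image.1 hz
    exact hf a)
  exact ⟨q, hq, fun a ha => hs (Finset.mem_image_of_mem _ ha)⟩

end Generic

/-! ### Compactness modulo automorphisms -/

section LocEq

variable (L : FirstOrder.Language.{u, v}) {M : Type w} [L.Structure M]

/-- The functions `f` and `g` agree on every finite set up to an automorphism of `M`. -/
def LocEq {X : Type*} (f g : X → M) : Prop :=
  ∀ F : Finset X, ∃ α : M ≃[L] M, ∀ x ∈ F, α (f x) = g x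

variable {L} {X : Type*}

theorem IsOmegaCategorical.exists_finite (hcat : IsOmegaCategorical L M) (ι : Type*) [Finite ι] :
    ∃ T : Set (ι → M), T.Finite ∧ ∀ x : ι → M, ∃ t ∈ T, ∃ α : M ≃[L] M, ∀ i, α (t i) = x i := by
  obtain ⟨n, ⟨e⟩⟩ := Finite.exists_equiv_fin ι
  obtain ⟨T, hT, h⟩ := hcat n
  refine ⟨(fun t => t ∘ e) '' T, hT.image _, fun x => ?_⟩
  obtain ⟨t, ht, α, hα⟩ := h (x ∘ e.symm)
  exact ⟨_, ⟨t, ht, rfl⟩, α, fun i => by simp [hα]⟩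

/-- Compactness of the space of functions modulo automorphisms of an `ω`-categorical structure. -/
theorem IsOmegaCategorical.exists_limit (hcat : IsOmegaCategorical L M) [Countable X]
    {ι : Type*} (U : Ultrafilter ι) (F : ι → X → M) :
    ∃ p : X → M, ∀ E : Finset X, ∀ᶠ i in U, ∃ α : M ≃[L] M, ∀ x ∈ E, α (F i x) = p x := by
  classical
  obtain ⟨p, -, hp⟩ := exists_fun_of_forth
    (fun r : Finset (X × M) => ∀ᶠ i in U, ∃ α : M ≃[L] M, ∀ z ∈ r, α (F i z.1) = z.2) ∅
    (Eventually.of_forall fun i => ⟨.refl L M, by simp⟩)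
    (fun r hr a b b' h h' => by
      obtain ⟨i, α, hα⟩ := hr.exists
      exact (hα _ h).symm.trans (hα _ h'))
    (fun r hr c => by
      -- `none` is the slot of the new point `c`. As there are finitely many representatives, one
      -- `t` serves for almost all `i`; a single index `i₀` then fixes the value at `c`.
      obtain ⟨T, hT, hT'⟩ := hcat.exists_finite (Option r)
      have h1 : ∀ᶠ i in U, ∃ t ∈ T, ∃ α β : M ≃[L] M, (∀ z ∈ r, α (F i z.1) = z.2) ∧
          β (t none) = α (F i c) ∧ ∀ z : r, β (t (some z)) = z.1.2 := by
        filter_upwards [hr] with i hi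
        obtain ⟨α, hα⟩ := hi
        obtain ⟨t, ht, β, hβ⟩ := hT' (fun o => o.elim (α (F i c)) fun z => z.1.2)
        exact ⟨t, ht, α, β, hα, hβ none, fun z => hβ (some z)⟩
      have h2 := (Ultrafilter.eventually_exists_mem_iff hT).1 h1
      obtain ⟨t, -, ht⟩ := h2
      obtain ⟨i₀, α₀, β₀, -, -, hβ₀⟩ := ht.exists
      refine ⟨insert (c, β₀ (t none)) r, Finset.subset_insert _ _, ?_, _,
        Finset.mem_insert_self _ _⟩
      filter_upwards [ht] with i hi
      obtain ⟨α, β, hα, hβ, hβ'⟩ := hi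
      refine ⟨β₀.comp (β.symm.comp α), ?_⟩
      intro z hz
      simp only [FirstOrder.Language.Equiv.comp_apply]
      rcases Finset.mem_insert.1 hz with rfl | hz
      · rw [← hβ, FirstOrder.Language.Equiv.symm_apply_apply]
      · rw [hα z hz, ← hβ' ⟨z, hz⟩, FirstOrder.Language.Equiv.symm_apply_apply]
        exact (hβ₀ ⟨z, hz⟩).trans (hβ' ⟨z, hz⟩).symm)
  refine ⟨p, fun E => ?_⟩
  obtain ⟨r, hr, hE⟩ := hp E
  filter_upwards [hr] with i hi
  obtain ⟨α, hα⟩ := hi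
  exact ⟨α, fun x hx => hα _ (hE x hx)⟩

end LocEq

/-! ### Homogeneity in terms of finite partial maps -/

section Homogeneity

variable {L : FirstOrder.Language.{u, v}} [L.IsRelational]
  {M : Type w} [L.Structure M]

/-- The map `φ` restricts to an isomorphism of relational structures from `E` onto its image. -/
structure IsEmbOn (L : FirstOrder.Language.{u, v}) {M N : Type*} [L.Structure M] [L.Structure N]
    (E : Set M) (φ : M → N) : Prop where
  inj : ∀ x ∈ E, ∀ y ∈ E, φ x = φ y → x = y
  rel : ∀ {n : ℕ} (R : L.Relations n) (x : Fin n → M), (∀ i, x i ∈ E) →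
    (Structure.RelMap R (fun i => φ (x i)) ↔ Structure.RelMap R x)

/-- A map that is an isomorphism onto its image, as an embedding of the induced substructure. -/
def IsEmbOn.toEmbedding {M N : Type*} [L.Structure M] [L.Structure N] {E : Set M} {φ : M → N}
    (h : IsEmbOn L E φ) : E ↪[L] N where
  toFun x := φ x
  inj' x y hxy := Subtype.ext (h.inj x x.2 y y.2 hxy)
  map_fun' f := isEmptyElim f
  map_rel' R x := h.rel R (fun i => (x i : M)) fun i => (x i).2

/-- The inclusion of an induced substructure. -/
def inclusionEmbedding (L : FirstOrder.Language.{u, v}) [L.IsRelational] {M : Type*} [L.Structure M]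
    (E : Set M) : E ↪[L] M where
  toFun x := x
  inj' _ _ h := Subtype.ext h
  map_fun' f := isEmptyElim f
  map_rel' _ _ := Iff.rfl

/-- Restriction of the codomain of an embedding to a set containing its range. -/
def codRestrictEmbedding {M N : Type*} [L.Structure M] [L.Structure N] (e : N ↪[L] M) (E : Set M)
    (h : ∀ x, e x ∈ E) : N ↪[L] E where
  toFun x := ⟨e x, h x⟩
  inj' _ _ hxy := e.injective (Subtype.ext_iff.1 hxy)
  map_fun' f := isEmptyElim f
  map_rel' R x := e.map_rel R x

theorem exists_equiv_of_isEmbOn (hhom : L.IsUltrahomogeneous M) {E : Set M} (hE : E.Finite)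
    {φ : M → M} (h : IsEmbOn L E φ) : ∃ α : M ≃[L] M, ∀ x ∈ E, α x = φ x := by
  let S : L.Substructure M := ⟨E, fun f => isEmptyElim f⟩
  have hS : Finite S := hE
  let e : S ↪[L] M :=
    { toFun := fun x => φ x
      inj' := fun x y hxy => Subtype.ext (h.inj x x.2 y y.2 hxy)
      map_fun' := fun f => isEmptyElim f
      map_rel' := fun R x => h.rel R (fun i => (x i : M)) fun i => (x i).2 }
  obtain ⟨α, hα⟩ := hhom S Substructure.FG.of_finite e
  exact ⟨α, fun x hx => (DFunLike.congr_fun hα (⟨x, hx⟩ : S)).symm⟩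

theorem exists_equiv_of_embeddings (hhom : L.IsUltrahomogeneous M) {N : Type*} [L.Structure N]
    [Finite N] (e e' : N ↪[L] M) : ∃ α : M ≃[L] M, ∀ x, α (e x) = e' x := by
  by_cases hN : Nonempty N
  · have hinv : ∀ x, Function.invFun e (e x) = x := Function.leftInverse_invFun e.injective
    obtain ⟨α, hα⟩ := exists_equiv_of_isEmbOn hhom (Set.finite_range e)
      (φ := fun y => e' (Function.invFun e y))
      { inj := by
          rintro _ ⟨x, rfl⟩ _ ⟨y, rfl⟩ hxy
          rw [hinv, hinv] at hxy
          rw [e'.injective hxy]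
        rel := by
          intro n R x hx
          choose y hy using hx
          obtain rfl : (fun i => e (y i)) = x := funext hy
          simp only [hinv]
          exact (e'.map_rel R y).trans (e.map_rel R y).symm }
    exact ⟨α, fun x => by rw [hα _ ⟨x, rfl⟩, hinv]⟩
  · exact ⟨.refl L M, fun x => (hN ⟨x⟩).elim⟩

theorem isUltrahomogeneous_of_isEmbOn
    (h : ∀ (E : Set M) (φ : M → M), E.Finite → IsEmbOn L E φ → ∃ α : M ≃[L] M, ∀ x ∈ E, α x = φ x) :
    L.IsUltrahomogeneous M := by
  classical
  intro S hS e
  have hfin : Finite S := hS.finite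
  let φ : M → M := fun x => if hx : x ∈ S then e ⟨x, hx⟩ else x
  have hφ : ∀ x : S, φ x = e x := fun x => by simp [φ]
  obtain ⟨α, hα⟩ := h S φ (Set.toFinite _)
    { inj := by
        intro x hx y hy hxy
        have := e.injective ((hφ ⟨x, hx⟩).symm.trans (hxy.trans (hφ ⟨y, hy⟩)))
        exact congrArg Subtype.val this
      rel := by
        intro n R x hx
        have h1 : (fun i => φ (x i)) = fun i => e ⟨x i, hx i⟩ := funext fun i => hφ ⟨x i, hx i⟩
        rw [h1]
        exact e.map_rel R fun i => ⟨x i, hx i⟩ }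
  exact ⟨α, FirstOrder.Language.Embedding.ext fun x : S => ((hα x x.2).trans (hφ x)).symm⟩

end Homogeneity

/-! ### From the Ramsey property to canonical functions -/

section Ramsey

variable {L : FirstOrder.Language.{u, v}} [L.IsRelational]
  {M : Type w} [L.Structure M]

theorem mem_age_of_finite (E : Set M) (hE : E.Finite) :
    CategoryTheory.Bundled.of (c := L.Structure) E ∈ L.age M :=
  ⟨@Structure.FG.of_finite L E _ hE, ⟨inclusionEmbedding L E⟩⟩

/-- A colouring of automorphisms only depending on the restriction to a finite set. -/
def IsLocalColouring (χ : (M ≃[L] M) → Bool) : Prop :=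
  ∃ E : Finset M, ∀ α β : M ≃[L] M, (∀ x ∈ E, α x = β x) → χ α = χ β

/-- By homogeneity, copies of a finite set E are restrictions of automorphisms, so a colouring local
on E is a colouring of copies of E. The Ramsey property is applied to the union of the sets α(E)
with α in `A`. -/
theorem IsRamsey.exists_monochromatic (hram : IsRamsey L M) (hhom : L.IsUltrahomogeneous M)
    {χ : (M ≃[L] M) → Bool} (hχ : IsLocalColouring χ) (A : Finset (M ≃[L] M)) :
    ∃ β : M ≃[L] M, ∀ α ∈ A, ∀ α' ∈ A, χ (β.comp α) = χ (β.comp α') := by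
  classical
  obtain ⟨E, hE⟩ := hχ
  let F : Finset M := A.biUnion fun α => E.image α
  have hSF := exists_equiv_of_embeddings (N := (E : Set M)) hhom (inclusionEmbedding L (E : Set M))
  choose ext hext using hSF
  obtain ⟨f, hf⟩ := hram _ (mem_age_of_finite (L := L) (E : Set M) E.finite_toSet)
    _ (mem_age_of_finite (L := L) (F : Set M) F.finite_toSet) (fun e => χ (ext e))
  obtain ⟨β, hβ⟩ := exists_equiv_of_embeddings (N := (F : Set M)) hhom
    (inclusionEmbedding L (F : Set M)) f
  have key : ∀ α ∈ A, ∃ e : (E : Set M) ↪[L] (F : Set M), χ (β.comp α) = χ (ext (f.comp e)) := by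
    intro α hα
    have hm : ∀ x : (E : Set M), (α.toEmbedding.comp (inclusionEmbedding L (E : Set M))) x ∈
        (F : Set M) := fun x =>
      Finset.mem_biUnion.2 ⟨α, hα, Finset.mem_image_of_mem _ x.2⟩
    refine ⟨codRestrictEmbedding _ _ hm, hE _ _ fun x hx => ?_⟩
    have h1 := hext (f.comp (codRestrictEmbedding _ _ hm)) ⟨x, hx⟩
    have h2 := hβ (codRestrictEmbedding _ _ hm ⟨x, hx⟩)
    exact h2.trans h1.symm
  refine ⟨β, fun α hα α' hα' => ?_⟩
  obtain ⟨e, he⟩ := key α hα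
  obtain ⟨e', he'⟩ := key α' hα'
  rw [he, he']
  exact hf e e'

/-- Induction on the number of colourings: `b A'` settles the new colouring on A', the other
colourings are replaced by their limits as A' grows, and the limits are again local. -/
theorem IsRamsey.exists_simultaneously_monochromatic (hram : IsRamsey L M)
    (hhom : L.IsUltrahomogeneous M) {ι : Type*} (J : Finset ι) :
    ∀ (χ : ι → (M ≃[L] M) → Bool), (∀ j, IsLocalColouring (χ j)) → ∀ A : Finset (M ≃[L] M),
      ∃ β : M ≃[L] M, ∀ j ∈ J, ∀ α ∈ A, ∀ α' ∈ A, χ j (β.comp α) = χ j (β.comp α') := by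
  classical
  induction J using Finset.induction_on with
  | empty => exact fun _ _ _ => ⟨.refl L M, by simp⟩
  | insert a J _ ih =>
    intro χ hχ A
    choose b hb using hram.exists_monochromatic hhom (hχ a)
    let U : Ultrafilter (Finset (M ≃[L] M)) := Ultrafilter.of atTop
    have hU : ∀ B, ∀ᶠ A' in (U : Filter (Finset (M ≃[L] M))), B ⊆ A' := fun B =>
      (Ultrafilter.of_le atTop : (U : Filter _) ≤ atTop) (eventually_ge_atTop B)
    let χ' : ι → (M ≃[L] M) → Bool := fun j γ => decide (∀ᶠ A' in U, χ j ((b A').comp γ) = true)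
    have hlim : ∀ j γ, ∀ᶠ A' in U, χ j ((b A').comp γ) = χ' j γ := by
      intro j γ
      by_cases h : ∀ᶠ A' in U, χ j ((b A').comp γ) = true
      · simp [χ', h]
      · have h' := Ultrafilter.eventually_not.2 h
        filter_upwards [h'] with A' hA'
        simp only [χ', h, decide_false]
        simpa using hA'
    have hχ' : ∀ j, IsLocalColouring (χ' j) := fun j => by
      obtain ⟨E, hE⟩ := hχ j
      refine ⟨E, fun α β h => ?_⟩
      obtain ⟨A', h1, h2⟩ := ((hlim j α).and (hlim j β)).exists
      rw [← h1, ← h2]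
      exact hE _ _ fun x hx => by simp [h x hx]
    obtain ⟨γ, hγ⟩ := ih χ' hχ' A
    have hev : ∀ᶠ A' in U, ∀ j ∈ J, ∀ α ∈ A,
        χ j ((b A').comp (γ.comp α)) = χ' j (γ.comp α) := by
      rw [Filter.eventually_all_finset]
      intro j _
      rw [Filter.eventually_all_finset]
      exact fun α _ => hlim j _
    obtain ⟨A', h1, h2⟩ := (hev.and (hU (A.image fun α => γ.comp α))).exists
    refine ⟨(b A').comp γ, fun j hj α hα α' hα' => ?_⟩
    rw [Equiv.comp_assoc, Equiv.comp_assoc]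
    rcases Finset.mem_insert.1 hj with rfl | hj
    · exact hb A' _ (h2 (Finset.mem_image_of_mem _ hα)) _ (h2 (Finset.mem_image_of_mem _ hα'))
    · rw [h1 j hj α hα, h1 j hj α' hα', hγ j hj α hα α' hα']

/-- A function is canonical if it preserves the orbit-equivalence of finite tuples. -/
def IsCanonical (L : FirstOrder.Language.{u, v}) {M : Type w} [L.Structure M] (f : M → M) : Prop :=
  ∀ α : M ≃[L] M, LocEq L f (f ∘ α)

/-- Colour β according to whether f ∘ β on a finite set lies in the orbit of t. Only finitely many t
are needed, so finitely many two-colourings determine the orbit. -/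
theorem IsRamsey.exists_finitely_canonical (hram : IsRamsey L M) (hhom : L.IsUltrahomogeneous M)
    (hcat : IsOmegaCategorical L M) (f : M → M) (p : Finset (Finset M × (M ≃[L] M))) :
    ∃ β : M ≃[L] M, ∀ z ∈ p, ∃ γ : M ≃[L] M, ∀ x ∈ z.1, γ (f (β x)) = f (β (z.2 x)) := by
  classical
  have hT := fun E : Finset M => hcat.exists_finite E
  choose T hTfin hT using hT
  let χ : (Σ E : Finset M, (E → M)) → (M ≃[L] M) → Bool := fun z β =>
    decide (∃ γ : M ≃[L] M, ∀ x : z.1, γ (z.2 x) = f (β x))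
  obtain ⟨β, hβ⟩ := hram.exists_simultaneously_monochromatic hhom
    ((p.image Prod.fst).sigma fun E => (hTfin E).toFinset) χ
    (fun z => ⟨z.1, fun α β h => by
      have : ∀ x : z.1, f (α x) = f (β x) := fun x => by rw [h x x.2]
      simp only [χ, this]⟩)
    -- The identity is included so that each f ∘ β ∘ α is compared with f ∘ β.
    (insert (.refl L M) (p.image Prod.snd))
  refine ⟨β, fun z hz => ?_⟩
  obtain ⟨t, ht, δ, hδ⟩ := hT z.1 fun x => f (β x)
  have h1 := hβ ⟨z.1, t⟩ (by simpa using ⟨⟨_, hz⟩, ht⟩) _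
    (Finset.mem_insert_self _ _) z.2 (Finset.mem_insert_of_mem (Finset.mem_image_of_mem _ hz))
  have h2 : χ ⟨z.1, t⟩ (β.comp (.refl L M)) = true := by
    simpa [χ] using ⟨δ, fun x hx => hδ ⟨x, hx⟩⟩
  rw [h2] at h1
  obtain ⟨ε, hε⟩ := of_decide_eq_true h1.symm
  refine ⟨ε.comp δ.symm, fun x hx => ?_⟩
  rw [← hδ ⟨x, hx⟩, FirstOrder.Language.Equiv.comp_apply, FirstOrder.Language.Equiv.symm_apply_apply]
  exact hε ⟨x, hx⟩

end Ramsey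

/-! ### Minimal left ideals and range-rigid endomorphisms -/

section RangeRigid

variable {LA : FirstOrder.Language.{u, v}} {LB : FirstOrder.Language.{u', v'}}
  [LA.IsRelational] {M : Type w} [LA.Structure M] [LB.Structure M]

/-- Every automorphism of a structure is an automorphism of each of its first-order reducts. -/
def IsFirstOrderReduct.equiv (hred : IsFirstOrderReduct LA LB M) (α : M ≃[LB] M) : M ≃[LA] M where
  toEquiv := α.toEquiv
  map_fun' f := isEmptyElim f
  map_rel' {n} R x := by
    obtain ⟨φ, hφ⟩ := Set.empty_definable_iff.1 (hred n R)
    have h : ∀ y : Fin n → M, Structure.RelMap R y ↔ φ.Realize y := fun y =>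
      (Set.ext_iff.1 hφ y)
    rw [h, h]
    exact StrongHomClass.realize_formula α φ

/-- A function that locally agrees with homomorphisms is a homomorphism. -/
def homOfLocal {N P : Type*} [LA.Structure N] [LA.Structure P] (p : N → P)
    (h : ∀ E : Finset N, ∃ f : N →[LA] P, ∀ x ∈ E, f x = p x) : N →[LA] P where
  toFun := p
  map_fun' f := isEmptyElim f
  map_rel' {n} R x hx := by
    classical
    obtain ⟨f, hf⟩ := h (Finset.univ.image x)
    have : p ∘ x = f ∘ x := funext fun i => (hf _ (by simp)).symm
    rw [this]
    exact f.map_rel R x hx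

/-- An endomorphism generating a minimal closed left ideal. -/
def IsMinimalEnd (L : FirstOrder.Language.{u, v}) {M : Type w} [L.Structure M] (f : M →[L] M) :
    Prop :=
  ∀ (h : M →[L] M) (F : Finset M), ∃ k : M →[L] M, ∀ x ∈ F, k (h (f x)) = f x

-- The closed left ideal generated by h ∘ g lies inside I, hence equals I by minimality and contains
-- g.
omit [LA.IsRelational] in
theorem InMinimalClosedLeftIdeal.isMinimalEnd {g : M →[LA] M}
    (hg : InMinimalClosedLeftIdeal LA g) : IsMinimalEnd LA g := by
  obtain ⟨I, hI, hgI⟩ := hg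
  intro h
  let J : Set (M →[LA] M) := {f | ∀ F : Finset M, ∃ k : M →[LA] M, ∀ x ∈ F, k (h (g x)) = f x}
  have hJ : IsClosedLeftIdeal LA J :=
    { nonempty := ⟨h.comp g, fun F => ⟨.id LA M, fun x _ => rfl⟩⟩
      comp_mem := fun u f hf F => by
        obtain ⟨k, hk⟩ := hf F
        exact ⟨u.comp k, fun x hx => by simp [hk x hx]⟩
      closed := fun f hf F => by
        obtain ⟨f', hf', h1⟩ := hf F
        obtain ⟨k, hk⟩ := hf' F
        exact ⟨k, fun x hx => (hk x hx).trans (h1 x hx)⟩ }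
  have hJI : J ⊆ I := fun f hf => hI.prop.closed f fun F => by
    obtain ⟨k, hk⟩ := hf F
    exact ⟨k.comp (h.comp g), hI.prop.comp_mem _ _ (hI.prop.comp_mem _ _ hgI), hk⟩
  exact hI.le_of_le hJ hJI hgI

-- The ideal is the closure of End ∘ f. Any element of a smaller ideal is locally some h ∘ f, which
-- can be turned back into f.
omit [LA.IsRelational] in
theorem IsMinimalEnd.inMinimalClosedLeftIdeal {f : M →[LA] M} (hf : IsMinimalEnd LA f) :
    InMinimalClosedLeftIdeal LA f := by
  refine ⟨{j | ∀ F : Finset M, ∃ k : M →[LA] M, ∀ x ∈ F, k (f x) = j x}, ⟨?_, ?_⟩,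
    fun F => ⟨.id LA M, fun x _ => rfl⟩⟩
  · exact
    { nonempty := ⟨f, fun F => ⟨.id LA M, fun x _ => rfl⟩⟩
      comp_mem := fun u j hj F => by
        obtain ⟨k, hk⟩ := hj F
        exact ⟨u.comp k, fun x hx => by simp [hk x hx]⟩
      closed := fun j hj F => by
        obtain ⟨f', hf', h1⟩ := hj F
        obtain ⟨k, hk⟩ := hf' F
        exact ⟨k, fun x hx => (hk x hx).trans (h1 x hx)⟩ }
  · intro J hJ hJI j hj
    obtain ⟨i, hi⟩ := hJ.nonempty
    have hfJ : f ∈ J := hJ.closed f fun F => by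
      obtain ⟨h, hh⟩ := hJI hi F
      obtain ⟨k, hk⟩ := hf h F
      exact ⟨k.comp i, hJ.comp_mem _ _ hi, fun x hx => by simp [← hh x hx, hk x hx]⟩
    exact hJ.closed j fun F => by
      obtain ⟨k, hk⟩ := hj F
      exact ⟨k.comp f, hJ.comp_mem _ _ hfJ, hk⟩

omit [LA.IsRelational] in
theorem IsMinimalEnd.comp_right {f : M →[LA] M} (hf : IsMinimalEnd LA f) (u : M →[LA] M) :
    IsMinimalEnd LA (f.comp u) := fun h F => by
  classical
  obtain ⟨k, hk⟩ := hf h (F.image u)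
  exact ⟨k, fun x hx => hk _ (Finset.mem_image_of_mem _ hx)⟩

theorem IsMinimalEnd.of_local (hred : IsFirstOrderReduct LA LB M) {p : M →[LA] M}
    (h : ∀ E : Finset M, ∃ f : M →[LA] M, IsMinimalEnd LA f ∧
      ∃ α : M ≃[LB] M, ∀ x ∈ E, α (f x) = p x) : IsMinimalEnd LA p := fun u F => by
  obtain ⟨f, hf, α, hα⟩ := h F
  obtain ⟨k, hk⟩ := hf (u.comp (hred.equiv α).toHom) F
  refine ⟨(hred.equiv α).toHom.comp k, fun x hx => ?_⟩
  have := hk x hx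
  rw [← hα x hx]
  exact congrArg α this

/-- Limits of endomorphisms of a reduct modulo automorphisms. -/
theorem exists_limit_end (hred : IsFirstOrderReduct LA LB M) (hcat : IsOmegaCategorical LB M)
    [Countable M] {ι : Type*} (U : Ultrafilter ι) (F : ι → M →[LA] M) :
    ∃ p : M →[LA] M, ∀ E : Finset M,
      ∀ᶠ i in (U : Filter ι), ∃ α : M ≃[LB] M, ∀ x ∈ E, α (F i x) = p x := by
  obtain ⟨p, hp⟩ := hcat.exists_limit U fun i => (F i : M → M)
  refine ⟨homOfLocal p fun E => ?_, hp⟩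
  obtain ⟨i, α, hα⟩ := (hp E).exists
  exact ⟨(hred.equiv α).toHom.comp (F i), hα⟩

/-- Zorn's lemma. A chain of ideals has non-empty intersection: choose a point in each ideal and
take a limit down the chain. Ideals absorb automorphisms on the left and are closed, so the limit
lies in all of them. -/
theorem exists_isMinimalEnd [Countable M] (hred : IsFirstOrderReduct LA LB M)
    (hcat : IsOmegaCategorical LB M) : ∃ f : M →[LA] M, IsMinimalEnd LA f := by
  have huniv : IsClosedLeftIdeal LA (Set.univ : Set (M →[LA] M)) :=
    ⟨⟨.id LA M, trivial⟩, fun _ _ _ => trivial, fun _ _ => trivial⟩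
  obtain ⟨I, -, hI⟩ := zorn_superset_nonempty {I : Set (M →[LA] M) | IsClosedLeftIdeal LA I}
    (fun c hc hchain hne => by
      have hne' : Nonempty c := hne.to_subtype
      let f : Filter c := ⨅ I : c, 𝓟 {J : c | J.1 ⊆ I.1}
      have : NeBot f := by
        refine iInf_neBot_of_directed' ?_ fun I => ?_
        · intro I J
          rcases hchain.total I.2 J.2 with h | h
          · exact ⟨I, le_rfl, principal_mono.2 fun K hK => Set.Subset.trans hK h⟩
          · exact ⟨J, principal_mono.2 fun K hK => Set.Subset.trans hK h, le_rfl⟩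
        · exact principal_neBot_iff.2 ⟨I, Set.Subset.refl I.1⟩
      let U : Ultrafilter c := Ultrafilter.of f
      have hU : ∀ I : c, ∀ᶠ J : c in (U : Filter c), J.1 ⊆ I.1 := fun I =>
        Ultrafilter.of_le f (mem_iInf_of_mem I
          (mem_principal_self {J : c | J.1 ⊆ I.1}))
      choose F hF using fun I : c => (hc I.2).nonempty
      obtain ⟨p, hp⟩ := exists_limit_end hred hcat U F
      refine ⟨⋂₀ c, ?_, fun s hs => Set.sInter_subset_of_mem hs⟩
      exact
      { nonempty := ⟨p, fun I hI => (hc hI).closed p fun E => by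
          obtain ⟨J, ⟨α, hα⟩, hJ⟩ := ((hp E).and (hU ⟨I, hI⟩)).exists
          exact ⟨(hred.equiv α).toHom.comp (F J), (hc hI).comp_mem _ _ (hJ (hF J)), hα⟩⟩
        comp_mem := fun h f hf I hI => (hc hI).comp_mem h f (hf I hI)
        closed := fun f hf I hI => (hc hI).closed f fun E => by
          obtain ⟨h, hh, h'⟩ := hf E
          exact ⟨h, hh I hI, h'⟩ })
    Set.univ huniv
  obtain ⟨f, hf⟩ := hI.prop.nonempty
  exact ⟨f, InMinimalClosedLeftIdeal.isMinimalEnd ⟨I, hI, hf⟩⟩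

/-- Minimal endomorphisms that are canonical. -/
def CanonicalMinimalEnd (LA : FirstOrder.Language.{u, v}) (LB : FirstOrder.Language.{u', v'})
    (M : Type w) [LA.Structure M] [LB.Structure M] : Type w :=
  {f : M →[LA] M // IsMinimalEnd LA f ∧ IsCanonical LB (f : M → M)}

-- Canonical functions act on tuples modulo automorphisms; this makes them closed under composition.
omit [LA.IsRelational] in
theorem IsCanonical.locEq {f : M → M} (hf : IsCanonical LB f) {X : Type*} {s t : X → M}
    (h : LocEq LB s t) : LocEq LB (f ∘ s) (f ∘ t) := fun F => by
  classical
  obtain ⟨α, hα⟩ := h F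
  obtain ⟨β, hβ⟩ := hf α (F.image s)
  refine ⟨β, fun x hx => ?_⟩
  have := hβ (s x) (Finset.mem_image_of_mem _ hx)
  rw [Function.comp_apply, hα x hx] at this
  exact this

omit [LA.IsRelational] in
theorem IsCanonical.comp {f g : M → M} (hf : IsCanonical LB f) (hg : IsCanonical LB g) :
    IsCanonical LB (f ∘ g) := fun α => hf.locEq (hg α)

instance : Semigroup (CanonicalMinimalEnd LA LB M) where
  mul f g := ⟨f.1.comp g.1, f.2.1.comp_right g.1, f.2.2.comp g.2.2⟩
  mul_assoc _ _ _ := rfl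

/-- Precomposing with automorphisms preserves minimality and achieves canonicity on any finite part;
a limit achieves it everywhere. -/
theorem exists_canonicalMinimalEnd [LB.IsRelational] [Countable M]
    (hred : IsFirstOrderReduct LA LB M)
    (hcat : IsOmegaCategorical LB M) (hhom : LB.IsUltrahomogeneous M) (hram : IsRamsey LB M) :
    Nonempty (CanonicalMinimalEnd LA LB M) := by
  classical
  obtain ⟨f, hf⟩ := exists_isMinimalEnd hred hcat
  choose β hβ using hram.exists_finitely_canonical hhom hcat f
  let U : Ultrafilter (Finset (Finset M × (M ≃[LB] M))) := Ultrafilter.of atTop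
  have hU : ∀ z, ∀ᶠ p in (U : Filter (Finset (Finset M × (M ≃[LB] M)))), z ∈ p := fun z => by
    have h := (Ultrafilter.of_le atTop : (U : Filter (Finset (Finset M × (M ≃[LB] M)))) ≤ atTop)
      (eventually_ge_atTop {z})
    filter_upwards [h] with p hp
    exact Finset.singleton_subset_iff.1 hp
  obtain ⟨g, hg⟩ := exists_limit_end hred hcat U fun p => f.comp (hred.equiv (β p)).toHom
  refine ⟨g, ?_, fun α F => ?_⟩
  · refine IsMinimalEnd.of_local hred fun E => ?_
    obtain ⟨p, hp⟩ := (hg E).exists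
    exact ⟨_, hf.comp_right _, hp⟩
  · obtain ⟨p, ⟨γ, hγ⟩, hz⟩ := ((hg (F ∪ F.image α)).and (hU (F, α))).exists
    obtain ⟨δ, hδ⟩ := hβ p _ hz
    refine ⟨γ.comp (δ.comp γ.symm), fun x hx => ?_⟩
    have h1 : γ (f (β p x)) = g x := hγ x (by simp [hx])
    have h2 : γ (f (β p (α x))) = g (α x) :=
      hγ (α x) (Finset.mem_union_right _ (Finset.mem_image_of_mem _ hx))
    have h3 : δ (f (β p x)) = f (β p (α x)) := hδ x hx
    simp only [FirstOrder.Language.Equiv.comp_apply, Function.comp_apply]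
    rw [← h1, FirstOrder.Language.Equiv.symm_apply_apply, h3, h2]

/-- Idempotency says that the limit p is, up to automorphisms, locally both f' and f ∘ f' for
generic f, f'. As f is canonical, the β inside p ∘ β ∘ p can be absorbed on the left: p ∘ β ∘ p ~ f
∘ β ∘ p ~ f ∘ f' ~ p. -/
theorem exists_isRangeRigid [LB.IsRelational] [Countable M] (hred : IsFirstOrderReduct LA LB M)
    (hcat : IsOmegaCategorical LB M) (hhom : LB.IsUltrahomogeneous M) (hram : IsRamsey LB M) :
    ∃ g : M →[LA] M, IsRangeRigid LB (g : M → M) ∧ InMinimalClosedLeftIdeal LA g := by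
  classical
  have := exists_canonicalMinimalEnd hred hcat hhom hram
  let C := CanonicalMinimalEnd LA LB M
  let : Semigroup (Ultrafilter C) := Ultrafilter.semigroup
  obtain ⟨U, hU⟩ : ∃ U : Ultrafilter C, U * U = U :=
    exists_idempotent_of_compact_t2_of_continuous_mul_left Ultrafilter.continuous_mul_left
  obtain ⟨p, hp⟩ := exists_limit_end hred hcat U fun f => f.1
  refine ⟨p, fun β F => ?_, (IsMinimalEnd.of_local hred fun E => ?_).inMinimalClosedLeftIdeal⟩
  · have h2 : ∀ᶠ f in (U : Filter C), ∀ᶠ f' in (U : Filter C),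
        ∃ α : M ≃[LB] M, ∀ x ∈ F, α (f.1 (f'.1 x)) = p x := by
      have := hp F
      rw [← hU] at this
      exact (Ultrafilter.eventually_mul U U _).1 this
    obtain ⟨f, hf, α₁, hα₁⟩ := (h2.and (hp (F.image fun x => β (p x)))).exists
    obtain ⟨f', ⟨α₂, hα₂⟩, α₃, hα₃⟩ := (hf.and (hp F)).exists
    obtain ⟨α₄, hα₄⟩ := f.2.2 (β.comp α₃) (F.image f'.1)
    refine ⟨α₂.comp (α₄.symm.comp α₁.symm), fun x hx => ?_⟩
    have e1 : α₁ (f.1 (β (p x))) = p (β (p x)) := hα₁ _ (Finset.mem_image_of_mem _ hx)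
    have e4 : α₄ (f.1 (f'.1 x)) = f.1 (β (p x)) := by
      rw [← hα₃ x hx]
      exact hα₄ _ (Finset.mem_image_of_mem _ hx)
    rw [← e1]
    simp only [FirstOrder.Language.Equiv.comp_apply, FirstOrder.Language.Equiv.symm_apply_apply]
    rw [← e4, FirstOrder.Language.Equiv.symm_apply_apply, hα₂ x hx]
  · obtain ⟨f, hf⟩ := (hp E).exists
    exact ⟨f.1, f.2.1, hf⟩

end RangeRigid

/-! ### The Fraïssé limit inside the structure -/

section Rich

variable {L : FirstOrder.Language.{u, v}} {M : Type w} [L.Structure M]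

/-- The function `g` agrees with an automorphism on the set `F`. -/
def IsGood (L : FirstOrder.Language.{u, v}) {M : Type w} [L.Structure M] (g : M → M) (F : Set M) :
    Prop :=
  ∃ γ : M ≃[L] M, ∀ x ∈ F, γ x = g x

variable {g : M → M}

theorem IsGood.mono {F F' : Set M} (h : IsGood L g F) (hF : F' ⊆ F) : IsGood L g F' := by
  obtain ⟨γ, hγ⟩ := h
  exact ⟨γ, fun x hx => hγ x (hF hx)⟩

/-- Let g y = α x for x in F. Range-rigidity with β = α⁻¹ gives δ with δ(g x) = δ(g(α⁻¹(g y))) = g y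
= α x, so g is δ⁻¹ ∘ α on F. -/
theorem IsRangeRigid.isGood (hg : IsRangeRigid L g) {F : Set M} (hF : F.Finite) (α : M ≃[L] M)
    (h : ∀ x ∈ F, α x ∈ Set.range g) : IsGood L g F := by
  classical
  obtain ⟨F, rfl⟩ := hF.exists_finset_coe
  choose! y hy using h
  obtain ⟨δ, hδ⟩ := hg α.symm (F.image y)
  refine ⟨δ.symm.comp α, fun x hx => ?_⟩
  have h1 := hδ (y x) (Finset.mem_image_of_mem _ hx)
  rw [hy x hx, FirstOrder.Language.Equiv.symm_apply_apply] at h1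
  rw [FirstOrder.Language.Equiv.comp_apply, ← h1, FirstOrder.Language.Equiv.symm_apply_apply]

theorem IsRangeRigid.isGood_image (hg : IsRangeRigid L g) {F : Set M} (hF : F.Finite)
    (h : IsGood L g F) (α : M ≃[L] M) : IsGood L g (α '' F) := by
  obtain ⟨γ, hγ⟩ := h
  refine hg.isGood (hF.image _) (γ.comp α.symm) ?_
  rintro _ ⟨x, hx, rfl⟩
  rw [FirstOrder.Language.Equiv.comp_apply, FirstOrder.Language.Equiv.symm_apply_apply]
  exact ⟨x, (hγ x hx).symm⟩

/-- Both automorphisms witnessing goodness equal g on A, so the two sets are amalgamated over A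
inside the range of g and pulled back by `γ₁`. -/
theorem IsRangeRigid.exists_amalgam (hg : IsRangeRigid L g) {A F : Set M} (hF : F.Finite)
    (hAF : A ⊆ F) (h : IsGood L g F) {b : M} (hb : IsGood L g (insert b A)) :
    ∃ γ : M ≃[L] M, (∀ a ∈ A, γ a = a) ∧ IsGood L g (insert (γ b) F) := by
  obtain ⟨γ₁, h₁⟩ := h
  obtain ⟨γ₂, h₂⟩ := hb
  refine ⟨γ₁.symm.comp γ₂, fun a ha => ?_, hg.isGood (hF.insert _) γ₁ fun x hx => ?_⟩
  · rw [FirstOrder.Language.Equiv.comp_apply, h₂ a (Set.mem_insert_of_mem _ ha), ← h₁ a (hAF ha),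
      FirstOrder.Language.Equiv.symm_apply_apply]
  · rcases hx with rfl | hx
    · rw [FirstOrder.Language.Equiv.comp_apply, FirstOrder.Language.Equiv.apply_symm_apply,
        h₂ b (Set.mem_insert _ _)]
      exact ⟨b, rfl⟩
    · exact ⟨x, (h₁ x hx).symm⟩

/-- A subset all of whose finite parts are good, and which realizes all good one-point extensions
of its finite parts. It carries the Fraïssé limit of the age of the range of `g`. -/
structure IsRich (L : FirstOrder.Language.{u, v}) {M : Type w} [L.Structure M] (g : M → M)
    (S : Set M) : Prop where
  isGood : ∀ A : Set M, A.Finite → A ⊆ S → IsGood L g A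
  extend : ∀ A : Set M, A.Finite → A ⊆ S → ∀ b, IsGood L g (insert b A) →
    ∃ γ : M ≃[L] M, (∀ a ∈ A, γ a = a) ∧ γ b ∈ S

theorem IsRangeRigid.exists_isRich [Countable M] (hg : IsRangeRigid L g) :
    ∃ S : Set M, IsRich L g S := by
  classical
  obtain ⟨S, -, hS, hD⟩ := exists_generic_set (ι := Finset M × M)
    (fun F => IsGood L g (F : Set M)) ∅ ⟨.refl L M, by simp⟩
    -- The first premise lets a condition incompatible with `i.1` meet the requirement vacuously; it
    -- holds automatically once `i.1` is contained in the generic set.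
    (fun i F => IsGood L g ((F ∪ i.1 : Finset M) : Set M) → IsGood L g (insert i.2 (i.1 : Set M)) →
      ∃ γ : M ≃[L] M, (∀ a ∈ i.1, γ a = a) ∧ γ i.2 ∈ F)
    (fun i p hp => by
      by_cases h1 : IsGood L g ((p ∪ i.1 : Finset M) : Set M)
      · by_cases h2 : IsGood L g (insert i.2 (i.1 : Set M))
        · obtain ⟨γ, h3, h4⟩ := hg.exists_amalgam (Finset.finite_toSet _) (by simp) h1 h2
          refine ⟨insert (γ i.2) (p ∪ i.1), fun x hx => by simp [hx], by simpa using h4, ?_⟩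
          exact fun _ _ => ⟨γ, h3, Finset.mem_insert_self _ _⟩
        · exact ⟨p, subset_rfl, hp, fun _ h => (h2 h).elim⟩
      · exact ⟨p, subset_rfl, hp, fun h => (h1 h).elim⟩)
  have hgood : ∀ A : Set M, A.Finite → A ⊆ S → IsGood L g A := fun A hA hAS => by
    obtain ⟨A, rfl⟩ := hA.exists_finset_coe
    obtain ⟨q, hq, hAq, -⟩ := hS A hAS
    exact hq.mono hAq
  refine ⟨S, hgood, fun A hA hAS b hb => ?_⟩
  obtain ⟨A, rfl⟩ := hA.exists_finset_coe
  obtain ⟨q, hqS, -, hq⟩ := hD (A, b)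
  obtain ⟨γ, h1, h2⟩ := hq (hgood _ (Finset.finite_toSet _) (by
    rw [Finset.coe_union]
    exact Set.union_subset hqS hAS)) hb
  exact ⟨γ, h1, hqS _ h2⟩

variable {S : Set M}

theorem IsRich.extend_equiv (hS : IsRich L g S) (hg : IsRangeRigid L g) {A : Set M} (hA : A.Finite)
    (α : M ≃[L] M) (hα : ∀ a ∈ A, α a ∈ S) {c : M} (hc : IsGood L g (insert c A)) :
    ∃ β : M ≃[L] M, (∀ a ∈ A, β a = α a) ∧ β c ∈ S := by
  obtain ⟨γ, h1, h2⟩ := hS.extend (α '' A) (hA.image _) (by rintro _ ⟨a, ha, rfl⟩; exact hα a ha)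
    (α c) (by
      rw [← Set.image_insert_eq]
      exact hg.isGood_image (hA.insert c) hc α)
  exact ⟨γ.comp α, fun a ha => h1 _ ⟨a, ha, rfl⟩, h2⟩

variable [L.IsRelational]

/-- A bijection that locally agrees with automorphisms of the ambient structure. -/
def equivOfLocal (f : S ≃ S) (h : ∀ E : Finset S, ∃ α : M ≃[L] M, ∀ x ∈ E, α x = f x) :
    S ≃[L] S where
  toEquiv := f
  map_fun' f := isEmptyElim f
  map_rel' {n} R x := by
    classical
    obtain ⟨α, hα⟩ := h (Finset.univ.image x)
    have : (fun i => (f (x i) : M)) = α ∘ fun i => (x i : M) :=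
      funext fun i => (hα _ (by simp)).symm
    change Structure.RelMap R (fun i => (f (x i) : M)) ↔ Structure.RelMap R fun i => (x i : M)
    rw [this]
    exact α.map_rel R _

/-- Back and forth: finite subsets of S are good, so richness supplies each missing value in S. -/
theorem IsRich.exists_equiv [Countable M] (hS : IsRich L g S) (hg : IsRangeRigid L g)
    (r : Finset (S × S)) (hr : ∃ α : M ≃[L] M, ∀ z ∈ r, α z.1 = z.2) :
    ∃ f : S ≃[L] S, ∀ a b, (a, b) ∈ r → f a = b := by
  classical
  have hfin : ∀ (p : Finset (S × S)) (pr : S × S → S),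
      ((fun z => (pr z : M)) '' (p : Set (S × S))).Finite :=
    fun p pr => p.finite_toSet.image _
  have hsub : ∀ (p : Finset (S × S)) (pr : S × S → S) (c : S),
      IsGood L g (insert (c : M) ((fun z => (pr z : M)) '' (p : Set (S × S)))) := fun p pr c =>
    hS.isGood _ ((hfin p pr).insert _) (by
      refine Set.insert_subset c.2 ?_
      rintro _ ⟨z, -, rfl⟩
      exact (pr z).2)
  obtain ⟨f, h0, hf⟩ := exists_equiv_of_back_and_forth
    (fun p : Finset (S × S) => ∃ α : M ≃[L] M, ∀ z ∈ p, α z.1 = z.2) r hr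
    (fun p ⟨α, hα⟩ a b a' b' h h' => by
      rw [← Subtype.coe_inj, ← Subtype.coe_inj, ← hα _ h, ← hα _ h', α.injective.eq_iff])
    (fun p ⟨α, hα⟩ c => by
      obtain ⟨β, h1, h2⟩ := hS.extend_equiv hg (hfin p Prod.fst) α
        (by rintro _ ⟨z, hz, rfl⟩; rw [hα z hz]; exact z.2.2) (hsub p Prod.fst c)
      refine ⟨insert (c, ⟨_, h2⟩) p, Finset.subset_insert _ _, ⟨β, fun z hz => ?_⟩, _,
        Finset.mem_insert_self _ _⟩
      rcases Finset.mem_insert.1 hz with rfl | hz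
      · rfl
      · rw [h1 _ ⟨z, hz, rfl⟩, hα z hz])
    (fun p ⟨α, hα⟩ c => by
      have hα' : ∀ z ∈ p, α.symm z.2 = z.1 := fun z hz => by
        rw [← hα z hz, FirstOrder.Language.Equiv.symm_apply_apply]
      obtain ⟨β, h1, h2⟩ := hS.extend_equiv hg (hfin p Prod.snd) α.symm
        (by rintro _ ⟨z, hz, rfl⟩; rw [hα' z hz]; exact z.1.2) (hsub p Prod.snd c)
      refine ⟨insert (⟨_, h2⟩, c) p, Finset.subset_insert _ _, ⟨β.symm, fun z hz => ?_⟩, _,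
        Finset.mem_insert_self _ _⟩
      rcases Finset.mem_insert.1 hz with rfl | hz
      · exact FirstOrder.Language.Equiv.symm_apply_apply _ _
      · rw [← hα' z hz, ← h1 _ ⟨z, hz, rfl⟩, FirstOrder.Language.Equiv.symm_apply_apply])
  refine ⟨equivOfLocal f fun E => ?_, h0⟩
  obtain ⟨p, ⟨α, hα⟩, hE⟩ := hf E
  exact ⟨α, fun x hx => hα _ (hE x hx)⟩

theorem IsRich.isUltrahomogeneous [Countable M] (hS : IsRich L g S) (hg : IsRangeRigid L g)
    (hhom : L.IsUltrahomogeneous M) : L.IsUltrahomogeneous S := by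
  classical
  refine isUltrahomogeneous_of_isEmbOn fun E φ hE hφ => ?_
  obtain ⟨E, rfl⟩ := hE.exists_finset_coe
  obtain ⟨α, hα⟩ := exists_equiv_of_embeddings (N := (E : Set S)) hhom
    ((inclusionEmbedding L S).comp (inclusionEmbedding L (E : Set S)))
    ((inclusionEmbedding L S).comp hφ.toEmbedding)
  obtain ⟨f, hf⟩ := hS.exists_equiv hg (E.image fun x => (x, φ x)) ⟨α, fun z hz => by
    obtain ⟨x, hx, rfl⟩ := Finset.mem_image.1 hz
    exact hα ⟨x, hx⟩⟩
  exact ⟨f, fun x hx => hf _ _ (Finset.mem_image_of_mem _ hx)⟩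

-- Only the forth direction is needed: finite subsets of the range of g are good, so they can be
-- copied into S point by point.
omit [L.IsRelational] in
theorem IsRich.exists_map [Countable M] (hS : IsRich L g S) (hg : IsRangeRigid L g) :
    ∃ h : M → S, LocEq L g fun x => (h x : M) := by
  classical
  obtain ⟨h, -, hh⟩ := exists_fun_of_forth
    (fun r : Finset (M × S) => ∃ α : M ≃[L] M, ∀ z ∈ r, α (g z.1) = z.2) ∅ ⟨.refl L M, by simp⟩
    (fun p ⟨α, hα⟩ a b b' h h' => Subtype.ext ((hα _ h).symm.trans (hα _ h')))
    (fun p ⟨α, hα⟩ c => by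
      have hfin : ((fun z : M × S => g z.1) '' (p : Set (M × S))).Finite :=
        p.finite_toSet.image _
      obtain ⟨β, h1, h2⟩ := hS.extend_equiv hg hfin α
        (by rintro _ ⟨z, hz, rfl⟩; rw [hα z hz]; exact z.2.2) (c := g c)
        (hg.isGood (hfin.insert _) (.refl L M) (by
          rintro _ (rfl | ⟨z, -, rfl⟩)
          exacts [⟨c, rfl⟩, ⟨_, rfl⟩]))
      refine ⟨insert (c, ⟨_, h2⟩) p, Finset.subset_insert _ _, ⟨β, fun z hz => ?_⟩, _,
        Finset.mem_insert_self _ _⟩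
      rcases Finset.mem_insert.1 hz with rfl | hz
      · rfl
      · rw [h1 _ ⟨z, hz, rfl⟩, hα z hz])
  refine ⟨h, fun E => ?_⟩
  obtain ⟨p, ⟨α, hα⟩, hE⟩ := hh E
  exact ⟨α, fun x hx => hα _ (hE x hx)⟩

theorem IsRangeRigid.isGood_range (hg : IsRangeRigid L g) (hhom : L.IsUltrahomogeneous M)
    {N : Type*} [L.Structure N] [Finite N] (e₀ : N ↪[L] Set.range g) (e : N ↪[L] M) :
    IsGood L g (Set.range e) := by
  obtain ⟨α, hα⟩ := exists_equiv_of_embeddings hhom e ((inclusionEmbedding L (Set.range g)).comp e₀)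
  refine hg.isGood (Set.finite_range e) α ?_
  rintro _ ⟨x, rfl⟩
  rw [hα]
  exact (e₀ x).2

theorem IsGood.exists_embedding {N : Type*} [L.Structure N] (e : N ↪[L] M) {T : Set M} {h : M → T}
    (he : IsGood L (fun x => (h x : M)) (Set.range e)) : ∃ e' : N ↪[L] T, ∀ x, e' x = h (e x) := by
  obtain ⟨γ, hγ⟩ := he
  have h1 : ∀ x, (γ.toEmbedding.comp e) x = h (e x) := fun x => hγ _ ⟨x, rfl⟩
  refine ⟨codRestrictEmbedding (γ.toEmbedding.comp e) T fun x => by rw [h1]; exact (h (e x)).2,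
    fun x => Subtype.ext (h1 x)⟩

omit [L.IsRelational] in
theorem LocEq.isGood {g h : M → M} (H : LocEq L g h) {F : Set M} (hF : F.Finite)
    (hgood : IsGood L g F) : IsGood L h F := by
  obtain ⟨F, rfl⟩ := hF.exists_finset_coe
  obtain ⟨α, hα⟩ := H F
  obtain ⟨γ, hγ⟩ := hgood
  exact ⟨α.comp γ, fun x hx => by rw [FirstOrder.Language.Equiv.comp_apply, hγ x hx, hα x hx]⟩

theorem IsRich.exists_embedding (hS : IsRich L g S) {N : Type*} [L.Structure N] [Finite N]
    (e : N ↪[L] S) : Nonempty (N ↪[L] Set.range g) := by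
  have hgood : IsGood L g (Set.range ((inclusionEmbedding L S).comp e)) :=
    hS.isGood _ (Set.finite_range _) (by rintro _ ⟨x, rfl⟩; exact (e x).2)
  obtain ⟨e', -⟩ := IsGood.exists_embedding (T := Set.range g)
    (h := fun x => ⟨g x, x, rfl⟩) ((inclusionEmbedding L S).comp e) hgood
  exact ⟨e'⟩

theorem IsRich.age_eq [Countable M] (hS : IsRich L g S) (hg : IsRangeRigid L g)
    (hhom : L.IsUltrahomogeneous M) : L.age S = L.age (Set.range g) := by
  obtain ⟨h, hh⟩ := hS.exists_map hg
  ext N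
  refine and_congr_right fun hN => ?_
  have : Finite N := hN.finite
  refine ⟨fun ⟨e⟩ => hS.exists_embedding e, fun ⟨e⟩ => ?_⟩
  obtain ⟨e', -⟩ := IsGood.exists_embedding ((inclusionEmbedding L (Set.range g)).comp e)
    (hh.isGood (Set.finite_range _) (hg.isGood_range hhom e _))
  exact ⟨e'⟩

/-- For K in the age of S, every copy of K in `M` is good, so h maps it to a copy in S. Colourings
pull back along h and monochromatic copies push forward. -/
theorem IsRich.isRamsey [Countable M] (hS : IsRich L g S) (hg : IsRangeRigid L g)
    (hhom : L.IsUltrahomogeneous M) (hram : IsRamsey L M) : IsRamsey L S := by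
  intro N hN F hF χ
  obtain ⟨h, hh⟩ := hS.exists_map hg
  have hage : L.age S ⊆ L.age M := (inclusionEmbedding L S).age_subset_age
  have push : ∀ K ∈ L.age S, ∀ e : K ↪[L] M, ∃ e' : K ↪[L] S, ∀ x, e' x = h (e x) := by
    intro K hK e
    have : Finite K := hK.1.finite
    obtain ⟨e₀⟩ := hS.exists_embedding hK.2.some
    exact IsGood.exists_embedding e (hh.isGood (Set.finite_range _) (hg.isGood_range hhom e₀ _))
  choose pN hpN using push N hN
  obtain ⟨f, hf⟩ := hram N (hage hN) F (hage hF) fun e => χ (pN e)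
  obtain ⟨f', hf'⟩ := push F hF f
  have key : ∀ e : N ↪[L] F, f'.comp e = pN (f.comp e) := fun e =>
    FirstOrder.Language.Embedding.ext fun x => by
      rw [hpN, FirstOrder.Language.Embedding.comp_apply, hf', FirstOrder.Language.Embedding.comp_apply]
  exact ⟨f', fun e e' => by rw [key, key]; exact hf e e'⟩

theorem IsRich.isOmegaCategorical [Countable M] (hS : IsRich L g S) (hg : IsRangeRigid L g)
    (hcat : IsOmegaCategorical L M) : IsOmegaCategorical L S := by
  classical
  intro n
  obtain ⟨T, hT, h⟩ := hcat n
  -- Only orbits meeting Sⁿ are kept, each with a representative chosen in S.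
  let T₀ := {t : T // ∃ s : Fin n → S, ∃ α : M ≃[L] M, ∀ i, α (t.1 i) = s i}
  have : Finite T := hT
  choose s α hs using fun t : T₀ => t.2
  refine ⟨Set.range s, Set.finite_range s, fun x => ?_⟩
  obtain ⟨t, ht, β, hβ⟩ := h fun i => x i
  let t₀ : T₀ := ⟨⟨t, ht⟩, x, β, hβ⟩
  obtain ⟨f, hf⟩ := hS.exists_equiv hg (Finset.univ.image fun i => (s t₀ i, x i))
    ⟨β.comp (α t₀).symm, fun z hz => by
      obtain ⟨i, -, rfl⟩ := Finset.mem_image.1 hz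
      rw [FirstOrder.Language.Equiv.comp_apply, ← hs t₀, FirstOrder.Language.Equiv.symm_apply_apply]
      exact hβ i⟩
  exact ⟨_, ⟨t₀, rfl⟩, f, fun i => hf _ _ (Finset.mem_image_of_mem _ (Finset.mem_univ i))⟩

end Rich

/-! ### Invariant relations are definable -/

section Definability

variable {L : FirstOrder.Language.{u, v}} {M : Type w} [L.Structure M]

theorem mem_of_definable {n : ℕ} {D : Set (Fin n → M)} (hD : (∅ : Set M).Definable L D)
    (α : M ≃[L] M) {x y : Fin n → M} (h : ∀ i, α (x i) = y i) : y ∈ D ↔ x ∈ D := by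
  obtain ⟨φ, hφ⟩ := Set.empty_definable_iff.1 hD
  have h' : ∀ y : Fin n → M, y ∈ D ↔ φ.Realize y := fun y => Set.ext_iff.1 hφ y
  obtain rfl : α ∘ x = y := funext h
  rw [h', h']
  exact StrongHomClass.realize_formula α φ

/-- Equalities and atomic relations among the entries already make t ↦ s a partial isomorphism,
which homogeneity extends. -/
theorem exists_equiv_of_definable [L.IsRelational] (hhom : L.IsUltrahomogeneous M) {n : ℕ}
    (t s : Fin n → M) (h : ∀ D : Set (Fin n → M), (∅ : Set M).Definable L D → t ∈ D → s ∈ D) :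
    ∃ α : M ≃[L] M, ∀ i, α (t i) = s i := by
  classical
  have hiff : ∀ D : Set (Fin n → M), (∅ : Set M).Definable L D → (s ∈ D ↔ t ∈ D) := fun D hD =>
    ⟨fun hs => by_contra fun ht => h Dᶜ hD.compl ht hs, h D hD⟩
  have heq : ∀ i j, s i = s j ↔ t i = t j := fun i j =>
    hiff {x | x i = x j} (Set.empty_definable_iff.2 ⟨(Term.var i).equal (Term.var j), by
      ext x
      simp⟩)
  have hrel : ∀ {m : ℕ} (R : L.Relations m) (σ : Fin m → Fin n),
      Structure.RelMap R (fun i => s (σ i)) ↔ Structure.RelMap R fun i => t (σ i) := fun R σ =>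
    hiff {x | Structure.RelMap R fun i => x (σ i)} (Set.empty_definable_iff.2
      ⟨R.formula fun i => Term.var (σ i), by
        ext x
        simp [Formula.realize_rel]⟩)
  let φ : M → M := fun y => if hy : ∃ i, t i = y then s hy.choose else y
  have hφ : ∀ i, φ (t i) = s i := fun i => by
    have hi : ∃ j, t j = t i := ⟨i, rfl⟩
    simp only [φ, hi, dite_true]
    exact (heq _ _).2 hi.choose_spec
  obtain ⟨α, hα⟩ := exists_equiv_of_isEmbOn hhom (Set.finite_range t) (φ := φ)
    { inj := by
        rintro _ ⟨i, rfl⟩ _ ⟨j, rfl⟩ hij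
        rw [hφ, hφ] at hij
        exact (heq i j).1 hij
      rel := by
        intro m R x hx
        choose σ hσ using hx
        obtain rfl : (fun i => t (σ i)) = x := funext hσ
        simp only [hφ]
        exact hrel R σ }
  exact ⟨α, fun i => by rw [hα _ ⟨i, rfl⟩, hφ]⟩

/-- In an `ω`-categorical homogeneous relational structure, invariant relations are definable. -/
theorem definable_of_invariant [L.IsRelational] (hhom : L.IsUltrahomogeneous M)
    (hcat : IsOmegaCategorical L M) {n : ℕ} (D : Set (Fin n → M))
    (hD : ∀ (α : M ≃[L] M) (x y : Fin n → M), (∀ i, α (x i) = y i) → x ∈ D → y ∈ D) :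
    (∅ : Set M).Definable L D := by
  classical
  obtain ⟨T, hT, h⟩ := hcat n
  have : Finite T := hT
  have : Finite {t : T // t.1 ∈ D} := inferInstance
  have hsep : ∀ t s : Fin n → M, ∃ ψ : Set (Fin n → M), (∅ : Set M).Definable L ψ ∧ t ∈ ψ ∧
      (s ∈ ψ → ∃ α : M ≃[L] M, ∀ i, α (t i) = s i) := fun t s => by
    by_contra! hcon
    obtain ⟨α, hα⟩ := exists_equiv_of_definable hhom t s fun D hD ht => (hcon D hD ht).1
    obtain ⟨i, hi⟩ := (hcon Set.univ Set.definable_univ trivial).2 α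
    exact hi (hα i)
  choose ψ hψ ht hs using hsep
  -- The signature may be infinite, but separating finitely many orbit representatives takes only
  -- finitely many formulas.
  have key : D = ⋃ t : {t : T // t.1 ∈ D}, ⋂ s : T, ψ t.1.1 s.1 := by
    ext x
    simp only [Set.mem_iUnion, Set.mem_iInter]
    constructor
    · intro hx
      obtain ⟨t, htT, α, hα⟩ := h x
      refine ⟨⟨⟨t, htT⟩, hD α.symm x t (fun i => ?_) hx⟩, fun s => ?_⟩
      · rw [← hα i, FirstOrder.Language.Equiv.symm_apply_apply]
      · exact (mem_of_definable (hψ _ _) α hα).2 (ht _ _)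
    · rintro ⟨t, hx⟩
      obtain ⟨s, hsT, α, hα⟩ := h x
      obtain ⟨β, hβ⟩ := hs t.1.1 s ((mem_of_definable (hψ _ _) α hα).1 (hx ⟨s, hsT⟩))
      exact hD α s x hα (hD β t.1.1 s hβ t.2)
  rw [key]
  exact Set.definable_iUnion_of_finite fun t => Set.definable_iInter_of_finite fun s => hψ _ _

theorem IsRich.isFirstOrderReduct {LA : FirstOrder.Language.{u', v'}} [LA.IsRelational]
    [LA.Structure M] [L.IsRelational] [Countable M] (hred : IsFirstOrderReduct LA L M)
    (hhom : L.IsUltrahomogeneous M) (hcat : IsOmegaCategorical L M) {g : M → M} {S : Set M}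
    (hS : IsRich L g S) (hg : IsRangeRigid L g) :
    IsFirstOrderReduct LA L S := by
  intro n R
  refine definable_of_invariant (hS.isUltrahomogeneous hg hhom) (hS.isOmegaCategorical hg hcat) _
    fun α x y hα hx => ?_
  obtain ⟨β, hβ⟩ := exists_equiv_of_embeddings hhom
    (N := (Set.range x)) ((inclusionEmbedding L S).comp (inclusionEmbedding L (Set.range x)))
    ((inclusionEmbedding L S).comp (α.toEmbedding.comp (inclusionEmbedding L (Set.range x))))
  have hβ' : ∀ i, β (x i) = y i := fun i => by
    rw [← hα i]
    exact hβ ⟨x i, i, rfl⟩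
  exact (mem_of_definable (hred n R) β hβ').2 hx

end Definability

/-! ### Finite bounds -/

section FinitelyBounded

variable {L : FirstOrder.Language.{u, v}} [L.IsRelational] {M : Type w} [L.Structure M]

theorem finite_structures (hL : Finite L.Symbols) (X : Type*) [Finite X] :
    Finite (L.Structure X) := by
  have h1 : Finite (Σ n, L.Relations n) := Finite.of_injective
    (fun r => (Sum.inr r : L.Symbols)) fun _ _ h => Sum.inr_injective h
  have h2 : Finite ((r : Σ n, L.Relations n) → (Fin r.1 → X) → Prop) := inferInstance
  refine Finite.of_injective
    (fun s : L.Structure X => fun (r : Σ n, L.Relations n) x => s.RelMap r.2 x) fun s s' h => ?_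
  ext n R x
  · exact isEmptyElim R
  · exact iff_of_eq (congrFun (congrFun h ⟨n, R⟩) x)

/-- Add to `𝓕` the small structures outside the age of S. If N avoids all of these, it embeds into
`M` by some e, small parts of its image are good, and g ∘ e embeds N into the range of g. -/
theorem IsRich.isFinitelyBounded [Countable M] {g : M → M} {S : Set M} (hS : IsRich L g S)
    (hg : IsRangeRigid L g) (hhom : L.IsUltrahomogeneous M) (hb : IsFinitelyBounded L M) :
    IsFinitelyBounded L S := by
  classical
  obtain ⟨hL, 𝓕, hfin, h𝓕, hage⟩ := hb
  refine ⟨hL, ?_⟩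
  have h1 : Finite (Σ n, L.Relations n) := Finite.of_injective
    (fun r => (Sum.inr r : L.Symbols)) fun _ _ h => Sum.inr_injective h
  -- Sizes below `m + 3` cover pairs, for injectivity, and the entries of one tuple of arity at most
  -- `m`.
  obtain ⟨m, hm⟩ : ∃ m, ∀ r : Σ n, L.Relations n, r.1 ≤ m := by
    obtain ⟨m, hm⟩ := (Set.finite_range fun r : Σ n, L.Relations n => r.1).bddAbove
    exact ⟨m, fun r => hm ⟨r, rfl⟩⟩
  have hfs : ∀ k : ℕ, Finite (L.Structure (ULift.{w} (Fin k))) := fun k => finite_structures hL _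
  let small : (Σ k : Fin (m + 3), L.Structure (ULift.{w} (Fin k))) →
      CategoryTheory.Bundled.{w} L.Structure := fun z => ⟨ULift.{w} (Fin z.1), z.2⟩
  have hage' := hS.age_eq hg hhom
  refine ⟨𝓕 ∪ (Set.range small \ L.age S), hfin.union ((Set.finite_range small).sdiff), ?_, ?_⟩
  · rintro F (hF | ⟨⟨z, rfl⟩, -⟩)
    · exact h𝓕 F hF
    · exact inferInstanceAs (Finite (ULift.{w} (Fin z.1)))
  intro N hN
  constructor
  · rintro hNS F (hF | ⟨-, hF⟩)
    · exact (hage N hN).1 ((inclusionEmbedding L S).age_subset_age hNS) F hF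
    · by_contra hcon
      obtain ⟨e⟩ := not_isEmpty_iff.1 hcon
      have : Finite F := Finite.of_injective e e.injective
      exact hF ⟨Structure.FG.of_finite, ⟨hNS.2.some.comp e⟩⟩
  · intro h
    have hNM : N ∈ L.age M := (hage N hN).2 fun F hF => h F (Or.inl hF)
    obtain ⟨e⟩ := hNM.2
    have hgood : ∀ A : Finset N, A.card < m + 3 → IsGood L g (e '' (A : Set N)) := by
      intro A hA
      let E : (A : Set N) ≃ ULift.{w} (Fin A.card) := A.equivFin.trans _root_.Equiv.ulift.symm
      let st : L.Structure (ULift.{w} (Fin A.card)) := _root_.Equiv.inducedStructure E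
      let eq : (A : Set N) ≃[L] ULift.{w} (Fin A.card) := _root_.Equiv.inducedStructureEquiv E
      have hmem : small ⟨⟨A.card, hA⟩, st⟩ ∈ L.age S := by
        by_contra hcon
        exact (h _ (Or.inr ⟨⟨_, rfl⟩, hcon⟩)).false
          ((inclusionEmbedding L (A : Set N)).comp eq.symm.toEmbedding)
      rw [hage'] at hmem
      obtain ⟨e₀⟩ := hmem.2
      have e₁ : (A : Set N) ↪[L] Set.range g :=
        FirstOrder.Language.Embedding.comp e₀ eq.toEmbedding
      have := hg.isGood_range hhom e₁ (e.comp (inclusionEmbedding L (A : Set N)))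
      refine this.mono ?_
      rintro _ ⟨x, hx, rfl⟩
      exact ⟨⟨x, hx⟩, rfl⟩
    rw [hage']
    refine ⟨hNM.1, ⟨⟨⟨fun x => ⟨g (e x), e x, rfl⟩, fun x y hxy => ?_⟩,
      fun f => isEmptyElim f, fun {n} R x => ?_⟩⟩⟩
    · obtain ⟨γ, hγ⟩ := hgood {x, y} (Finset.card_le_two.trans_lt (by omega))
      have h2 : g (e x) = g (e y) := Subtype.ext_iff.1 hxy
      rw [← hγ (e x) ⟨x, by simp, rfl⟩, ← hγ (e y) ⟨y, by simp, rfl⟩] at h2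
      exact e.injective (γ.injective h2)
    · obtain ⟨γ, hγ⟩ := hgood (Finset.univ.image x) (Finset.card_image_le.trans_lt (by
        have : n ≤ m := hm ⟨n, R⟩
        simp only [Finset.card_univ, Fintype.card_fin]
        omega))
      have h2 : (fun i => g (e (x i))) = γ ∘ e ∘ x := funext fun i =>
        (hγ _ ⟨x i, by simp, rfl⟩).symm
      change Structure.RelMap R (fun i => g (e (x i))) ↔ _
      rw [h2]
      exact (γ.map_rel R _).trans (e.map_rel R x)

end FinitelyBounded

/-! ### Model-complete cores -/

section Core

variable {L : FirstOrder.Language.{u, v}}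

/-- Every endomorphism can locally be undone by an endomorphism. -/
def IsLocallyInvertible (L : FirstOrder.Language.{u, v}) (N : Type*) [L.Structure N] : Prop :=
  ∀ (e : N →[L] N) (F : Finset N), ∃ k : N →[L] N, ∀ x ∈ F, k (e x) = x

theorem IsModelCompleteCore.isLocallyInvertible {N : Type*} [L.Structure N]
    (h : IsModelCompleteCore L N) : IsLocallyInvertible L N := fun e F => by
  obtain ⟨α, hα⟩ := h e F
  exact ⟨α.symm.toHom, fun x hx => by
    rw [← hα x hx]
    exact FirstOrder.Language.Equiv.symm_apply_apply α x⟩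

variable [L.IsRelational]

/-- Back and forth with homomorphisms e, k that are mutually inverse on the finite part; local
invertibility corrects k or e after a point is added. With N = P this gives the core property, with
F = ∅ uniqueness. -/
theorem exists_equiv_of_isLocallyInvertible {N P : Type*} [L.Structure N] [L.Structure P]
    [Countable N] [Countable P] (hN : IsLocallyInvertible L N) (hP : IsLocallyInvertible L P)
    (e : N →[L] P) (k : P →[L] N) (F : Finset N) : ∃ f : N ≃[L] P, ∀ x ∈ F, f x = e x := by
  classical
  obtain ⟨f, h0, hf⟩ := exists_equiv_of_back_and_forth
    (fun r : Finset (N × P) => ∃ (e : N →[L] P) (k : P →[L] N), ∀ z ∈ r, e z.1 = z.2 ∧ k z.2 = z.1)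
    (F.image fun x => (x, e x))
    (by
      obtain ⟨i, hi⟩ := hN (k.comp e) F
      refine ⟨e, i.comp k, fun z hz => ?_⟩
      obtain ⟨x, hx, rfl⟩ := Finset.mem_image.1 hz
      exact ⟨rfl, hi x hx⟩)
    (fun r ⟨e, k, h⟩ a b a' b' hab hab' => by
      constructor
      · rintro rfl
        exact (h _ hab).1.symm.trans (h _ hab').1
      · rintro rfl
        exact (h _ hab).2.symm.trans (h _ hab').2)
    (fun r ⟨e, k, h⟩ a => by
      obtain ⟨i, hi⟩ := hN (k.comp e) (insert a (r.image Prod.fst))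
      refine ⟨insert (a, e a) r, Finset.subset_insert _ _, ⟨e, i.comp k, fun z hz => ?_⟩, _,
        Finset.mem_insert_self _ _⟩
      rcases Finset.mem_insert.1 hz with rfl | hz
      · exact ⟨rfl, hi a (Finset.mem_insert_self _ _)⟩
      · refine ⟨(h z hz).1, ?_⟩
        rw [← (h z hz).1]
        exact hi _ (Finset.mem_insert_of_mem (Finset.mem_image_of_mem _ hz)))
    (fun r ⟨e, k, h⟩ b => by
      obtain ⟨i, hi⟩ := hP (e.comp k) (insert b (r.image Prod.snd))
      refine ⟨insert (k b, b) r, Finset.subset_insert _ _, ⟨i.comp e, k, fun z hz => ?_⟩, _,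
        Finset.mem_insert_self _ _⟩
      rcases Finset.mem_insert.1 hz with rfl | hz
      · exact ⟨hi b (Finset.mem_insert_self _ _), rfl⟩
      · refine ⟨?_, (h z hz).2⟩
        rw [← (h z hz).2]
        exact hi _ (Finset.mem_insert_of_mem (Finset.mem_image_of_mem _ hz)))
  refine ⟨⟨f, fun f => isEmptyElim f, fun {n} R x => ?_⟩,
    fun x hx => h0 _ _ (Finset.mem_image_of_mem _ hx)⟩
  obtain ⟨r, ⟨e, k, h⟩, hr⟩ := hf (Finset.univ.image x)
  have hx : ∀ i, (x i, f (x i)) ∈ r := fun i => hr _ (by simp)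
  have he : f ∘ x = e ∘ x := funext fun i => (h _ (hx i)).1.symm
  have hk : x = k ∘ f ∘ x := funext fun i => (h _ (hx i)).2.symm
  change Structure.RelMap R (f ∘ x) ↔ Structure.RelMap R x
  constructor
  · intro h
    rw [hk]
    exact k.map_rel R _ h
  · intro h
    rw [he]
    exact e.map_rel R _ h

theorem IsLocallyInvertible.isModelCompleteCore {N : Type*} [L.Structure N] [Countable N]
    (h : IsLocallyInvertible L N) : IsModelCompleteCore L N := fun e F =>
  exists_equiv_of_isLocallyInvertible h h e (.id L N) F

theorem IsRich.isLocallyInvertible {LB : FirstOrder.Language.{u', v'}} [LB.IsRelational]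
    {M : Type w} [L.Structure M] [LB.Structure M] [Countable M] (hred : IsFirstOrderReduct L LB M)
    {g : M →[L] M} {S : Set M} (hS : IsRich LB (g : M → M) S) (hg : IsRangeRigid LB (g : M → M))
    (hredS : IsFirstOrderReduct L LB S)
    (hmin : IsMinimalEnd L g) :
    IsLocallyInvertible L S ∧ Nonempty (M →[L] S) := by
  classical
  obtain ⟨h, hh⟩ := hS.exists_map hg
  have hι : ∀ E : Finset M, ∃ f : M →[L] M, ∀ x ∈ E, f x = h x := fun E => by
    obtain ⟨α, hα⟩ := hh E
    exact ⟨(hred.equiv α).toHom.comp g, hα⟩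
  let hM : M →[L] M := homOfLocal (fun x => (h x : M)) hι
  let hhom : M →[L] S :=
    { toFun := h
      map_fun' := fun f => isEmptyElim f
      map_rel' := fun R x hx => hM.map_rel R x hx }
  let ι : S →[L] M := (inclusionEmbedding L S).toHom
  have hminM : IsMinimalEnd L hM := IsMinimalEnd.of_local hred fun E => ⟨g, hmin, hh E⟩
  refine ⟨fun e F => ?_, ⟨hhom⟩⟩
  -- Finite subsets of S are good, so h ∘ h is locally an automorphism there, and its inverse
  -- extends to Aut(S).
  obtain ⟨γ, hγ⟩ : ∃ γ : S ≃[LB] S, ∀ x ∈ F, γ (h (h x)) = x := by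
    let A : Set M := (fun x : S => (x : M)) '' (F : Set S)
    have hA : A.Finite := F.finite_toSet.image _
    obtain ⟨α, hα⟩ := hh.isGood hA
      (hS.isGood A hA (by rintro _ ⟨x, -, rfl⟩; exact x.2))
    let B : Set M := (fun x : S => (h x : M)) '' (F : Set S)
    have hB : B.Finite := F.finite_toSet.image _
    obtain ⟨β, hβ⟩ := hh.isGood hB
      (hS.isGood B hB (by rintro _ ⟨x, -, rfl⟩; exact (h x).2))
    obtain ⟨γ, hγ⟩ := hS.exists_equiv hg (F.image fun x : S => (h (h x), x))
      ⟨α.symm.comp β.symm, fun z hz => by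
        obtain ⟨x, hx, rfl⟩ := Finset.mem_image.1 hz
        have h1 : α x = h x := hα _ ⟨x, hx, rfl⟩
        have h2 : β (h x) = h (h x) := hβ _ ⟨x, hx, rfl⟩
        change α.symm (β.symm (h (h x))) = x
        rw [← h2, FirstOrder.Language.Equiv.symm_apply_apply, ← h1,
          FirstOrder.Language.Equiv.symm_apply_apply]⟩
    exact ⟨γ, fun x hx => hγ _ _ (Finset.mem_image_of_mem _ hx)⟩
  let γ' : S →[L] S := (hredS.equiv γ).toHom
  -- Inserting γ ∘ h before e makes minimality give k(e(γ(h(h x)))) = h x, that is, k(e x) = h x.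
  obtain ⟨k, hk⟩ := hminM (ι.comp (e.comp (γ'.comp hhom))) (F.image Subtype.val)
  refine ⟨γ'.comp (hhom.comp (k.comp ι)), fun x hx => ?_⟩
  have h1 : k (e (γ (h (h x)))) = h x := hk x (Finset.mem_image_of_mem _ hx)
  rw [hγ x hx] at h1
  change γ (h (k (e x))) = x
  rw [h1, hγ x hx]

end Core

end CoreRamsey

/-! ### The theorem assembled -/

theorem theorem1p4 {LA : FirstOrder.Language.{u, v}}
    {LB : FirstOrder.Language.{u', v'}} [LA.IsRelational] [LB.IsRelational]
    (M : Type w) [Countable M] [LA.Structure M] [LB.Structure M]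
    (hred : CoreRamsey.IsFirstOrderReduct LA LB M)
    (hcat : CoreRamsey.IsOmegaCategorical LB M)
    (hhom : LB.IsUltrahomogeneous M)
    (hramsey : CoreRamsey.IsRamsey LB M) :
    (∃ g : M →[LA] M,
      CoreRamsey.IsRangeRigid LB g ∧ CoreRamsey.InMinimalClosedLeftIdeal LA g) ∧
    ∀ g : M →[LA] M, CoreRamsey.IsRangeRigid LB g → CoreRamsey.InMinimalClosedLeftIdeal LA g →
      ∃ S : Set M,
        FirstOrder.Language.IsFraisseLimit (LB.age (Set.range g)) S ∧
        CoreRamsey.IsOmegaCategorical LB S ∧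
        LB.IsUltrahomogeneous S ∧
        CoreRamsey.IsRamsey LB S ∧
        (CoreRamsey.IsFinitelyBounded LB M → CoreRamsey.IsFinitelyBounded LB S) ∧
        CoreRamsey.IsFirstOrderReduct LA LB S ∧
        CoreRamsey.IsModelCompleteCoreOf LA S M ∧
        ∀ (N : Type w') [Countable N] [LA.Structure N],
          CoreRamsey.IsModelCompleteCoreOf LA N M → Nonempty (N ≃[LA] S) := by
  refine ⟨CoreRamsey.exists_isRangeRigid hred hcat hhom hramsey, fun g hg hmin => ?_⟩
  obtain ⟨S, hS⟩ := hg.exists_isRich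
  have hredS := hS.isFirstOrderReduct hred hhom hcat hg
  have hhomS := hS.isUltrahomogeneous hg hhom
  obtain ⟨hinv, ⟨r⟩⟩ := hS.isLocallyInvertible hred hg hredS hmin.isMinimalEnd
  refine ⟨S, ⟨hhomS, hS.age_eq hg hhom⟩, hS.isOmegaCategorical hg hcat, hhomS,
    hS.isRamsey hg hhom hramsey, hS.isFinitelyBounded hg hhom, hredS,
    ⟨hinv.isModelCompleteCore, ⟨(CoreRamsey.inclusionEmbedding LA S).toHom⟩, ⟨r⟩⟩, ?_⟩
  rintro N _ _ ⟨hN, ⟨p⟩, ⟨q⟩⟩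
  -- Both cores are homomorphically equivalent to `M`, hence to each other.
  obtain ⟨f, -⟩ := CoreRamsey.exists_equiv_of_isLocallyInvertible hN.isLocallyInvertible hinv
    (r.comp p) (q.comp (CoreRamsey.inclusionEmbedding LA S).toHom) ∅
  exact ⟨f⟩
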